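/- Let $(M,g)$ be an oriented smooth Riemannian $4$-manifold (without boundary) with Hodge star $\star$, and let $F$ be a smooth closed $2$-form on $M$ that is self-dual ($\star F=F$) or anti-self-dual ($\star F=-F$). Let $g^{-1}F$ denote the endomorphism of $TM$ with $g(v,(g^{-1}F)w)=F(v,w)$; the endomorphism $I-(g^{-1}F)^2$ is always invertible, and $\sqrt{\det(I-g^{-1}F)}\;g\,(I-(g^{-1}F)^2)^{-1}g^{-1}F$ is a $2$-form, namely $(v,w)\mapsto\sqrt{\det(I-g^{-1}F)}\;g\big(v,(I-(g^{-1}F)^2)^{-1}(g^{-1}F)w\big)$. Then $$\sqrt{\det(I-g^{-1}F)}\;g\,\big(I-(g^{-1}F)^2\big)^{-1}g^{-1}F=F\quad\text{on } M,$$ and $F$ is a solution of the Born–Infeld equation $$d^*\!\left(\sqrt{\det(I-g^{-1}F)}\;g\,\big(I-(g^{-1}F)^2\big)^{-1}g^{-1}F\right)=0 ,$$ where $d^*=-\star d\star$ is the codifferential on $2$-forms. -/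

import Mathlib

open Module Set Filter Topology Manifold ContDiff Bundle RealInnerProductSpace

noncomputable section

namespace BornInfeld

/-! ### Pointwise constructions on a Euclidean space `V` -/

section Pointwise

variable {V : Type*} [NormedAddCommGroup V] [InnerProductSpace ℝ V] [FiniteDimensional ℝ V]

theorem update_zero {X : Type*} (a b v : X) : Function.update ![a, b] 0 v = ![v, b] := by
  ext i; fin_cases i <;> rfl

theorem update_one {X : Type*} (a b v : X) : Function.update ![a, b] 1 v = ![a, v] := by
  ext i; fin_cases i <;> rfl

/-- The endomorphism `g⁻¹F` obtained from a `2`-form `F` by raising its first index with the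
inner product `g`, i.e. `g (v, (g⁻¹F) w) = F (v, w)`; see `inner_sharp`. -/
def sharp (F : V [⋀^Fin 2]→L[ℝ] ℝ) : End ℝ V where
  toFun w := (InnerProductSpace.toDual ℝ V).symm (F.toContinuousLinearMap ![0, w] 0)
  map_add' w₁ w₂ := by
    rw [← map_add]
    congr 1
    ext v
    have h := F.map_update_add ![v, 0] 1 w₁ w₂
    rw [update_one, update_one, update_one] at h
    change F (Function.update ![0, w₁ + w₂] 0 v) =
      F (Function.update ![0, w₁] 0 v) + F (Function.update ![0, w₂] 0 v)
    rw [update_zero, update_zero, update_zero, h]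
  map_smul' c w := by
    rw [← map_smulₛₗ]
    congr 1
    ext v
    have h := F.map_update_smul ![v, 0] 1 c w
    rw [update_one, update_one] at h
    change F (Function.update ![0, c • w] 0 v) = c • F (Function.update ![0, w] 0 v)
    rw [update_zero, update_zero, h]

theorem inner_sharp (F : V [⋀^Fin 2]→L[ℝ] ℝ) (v w : V) : ⟪v, sharp F w⟫ = F ![v, w] := by
  rw [real_inner_comm]
  simp only [sharp, LinearMap.coe_mk, AddHom.coe_mk, InnerProductSpace.toDual_symm_apply]
  change F (Function.update ![0, w] 0 v) = F ![v, w]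
  rw [update_zero]

theorem inner_sharp_left (F : V [⋀^Fin 2]→L[ℝ] ℝ) (v w : V) :
    ⟪sharp F v, w⟫ = -⟪v, sharp F w⟫ := by
  rw [real_inner_comm, inner_sharp, inner_sharp]
  have h := F.toAlternatingMap.map_swap ![v, w] (i := 0) (j := 1) (by decide)
  have e : ![v, w] ∘ Equiv.swap (0 : Fin 2) 1 = ![w, v] := by
    ext i; fin_cases i <;> simp
  rw [e] at h
  exact h

/-- `I - (g⁻¹F)²` is always invertible. -/
theorem isUnit_one_sub_sharp_sq (F : V [⋀^Fin 2]→L[ℝ] ℝ) :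
    IsUnit (1 - sharp F ^ 2 : End ℝ V) := by
  rw [LinearMap.isUnit_iff_ker_eq_bot, LinearMap.ker_eq_bot']
  intro v hv
  have h : ⟪v, (1 - sharp F ^ 2 : End ℝ V) v⟫ = ⟪v, v⟫ + ⟪sharp F v, sharp F v⟫ := by
    rw [inner_sharp_left]
    simp [pow_two, sub_eq_add_neg, inner_add_right]
  rw [hv, inner_zero_right] at h
  have h1 : (0 : ℝ) ≤ ⟪sharp F v, sharp F v⟫ := real_inner_self_nonneg
  have h2 : (0 : ℝ) ≤ ⟪v, v⟫ := real_inner_self_nonneg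
  exact inner_self_eq_zero (𝕜 := ℝ).1 (by linarith)

/-- The endomorphism `(I - (g⁻¹F)²)⁻¹ g⁻¹F`. -/
def resolvent (F : V [⋀^Fin 2]→L[ℝ] ℝ) : End ℝ V :=
  Ring.inverse (1 - sharp F ^ 2) * sharp F

theorem inner_resolvent_self (F : V [⋀^Fin 2]→L[ℝ] ℝ) (v : V) : ⟪v, resolvent F v⟫ = 0 := by
  set A := sharp F with hA
  set B : End ℝ V := 1 - A ^ 2 with hB
  have hu : IsUnit B := isUnit_one_sub_sharp_sq F
  have hinv : B * Ring.inverse B = 1 := Ring.mul_inverse_cancel B hu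
  have hcomm : Commute A B := by
    rw [hB]; exact (Commute.one_right A).sub_right ((Commute.refl A).pow_right 2)
  set u := Ring.inverse B v with hu'
  have hv : v = B u := by
    rw [hu', ← Module.End.mul_apply, hinv, Module.End.one_apply]
  have hr : resolvent F v = A u := by
    have h1 : Ring.inverse B * A = A * Ring.inverse B := by
      have h2 : Ring.inverse B * B = 1 := Ring.inverse_mul_cancel B hu
      calc Ring.inverse B * A = Ring.inverse B * A * (B * Ring.inverse B) := by rw [hinv, mul_one]
        _ = Ring.inverse B * (A * B) * Ring.inverse B := by noncomm_ring
        _ = Ring.inverse B * (B * A) * Ring.inverse B := by rw [hcomm.eq]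
        _ = (Ring.inverse B * B) * A * Ring.inverse B := by noncomm_ring
        _ = A * Ring.inverse B := by rw [h2, one_mul]
    change (Ring.inverse B * A) v = A u
    rw [h1]; rfl
  have hskew : ∀ x : V, ⟪x, A x⟫ = 0 := by
    intro x
    have h := inner_sharp_left F x x
    rw [real_inner_comm] at h
    rw [hA]; linarith
  rw [hr, hv]
  have h3 : ⟪A (A u), A u⟫ = 0 := by
    rw [real_inner_comm]; exact hskew (A u)
  simp [hB, pow_two, inner_sub_left, hskew, h3]

/-- The Born–Infeld field `√det(I - g⁻¹F) g (I - (g⁻¹F)²)⁻¹ g⁻¹F` of the `2`-form `F`, i.e. the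
`2`-form `(v, w) ↦ √det(I - g⁻¹F) g (v, (I - (g⁻¹F)²)⁻¹ g⁻¹F w)`. -/
def fieldForm (F : V [⋀^Fin 2]→L[ℝ] ℝ) : V [⋀^Fin 2]→L[ℝ] ℝ where
  toFun v := √(LinearMap.det (1 - sharp F)) * ⟪v 0, resolvent F (v 1)⟫
  map_update_add' := @fun inst v i x y => by
    rw [Subsingleton.elim inst (instDecidableEqFin 2)]
    fin_cases i <;> simp [inner_add_left, inner_add_right, mul_add]
  map_update_smul' := @fun inst v i c x => by
    rw [Subsingleton.elim inst (instDecidableEqFin 2)]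
    fin_cases i <;> simp [inner_smul_left, inner_smul_right] <;> ring
  map_eq_zero_of_eq' v i j hv hij := by
    have h01 : v 0 = v 1 := by
      fin_cases i <;> fin_cases j <;> simp_all
    rw [h01, inner_resolvent_self, mul_zero]
  cont := by
    have h : Continuous (resolvent F) := LinearMap.continuous_of_finiteDimensional _
    change Continuous fun v : Fin 2 → V =>
      √(LinearMap.det (1 - sharp F)) * ⟪v 0, resolvent F (v 1)⟫
    fun_prop

theorem append_update {X : Type*} {k l : ℕ} (a : Fin k → X) (v : Fin l → X) (i : Fin l) (x : X) :
    Fin.append a (Function.update v i x) =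
      Function.update (Fin.append a v) (Fin.natAdd k i) x := by
  ext j
  refine Fin.addCases (fun p => ?_) (fun p => ?_) j
  · have hne : Fin.castAdd l p ≠ Fin.natAdd k i := by
      intro h
      have h' := congrArg Fin.val h
      simp only [Fin.val_castAdd, Fin.val_natAdd] at h'
      omega
    rw [Function.update_of_ne hne, Fin.append_left, Fin.append_left]
  · rw [Fin.append_right]
    by_cases hp : p = i
    · subst hp; simp
    · have hne : Fin.natAdd k p ≠ Fin.natAdd k i := by simpa using hp
      rw [Function.update_of_ne hne, Function.update_of_ne hp, Fin.append_right]

/-- The Hodge star `Λᵏ V* → Λˡ V*` of an oriented Euclidean space of dimension `n = k + l`, as the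
contraction of `α` with the volume form `vol`:
`(⋆α)(v₁, …, vₗ) = (1 / k!) ∑ α(e_{i₁}, …, e_{iₖ}) vol(e_{i₁}, …, e_{iₖ}, v₁, …, vₗ)`, where `e` is
an orthonormal basis and the sum runs over all `(i₁, …, iₖ)`. The sum does not depend on `e`. -/
def hodgeStar {n : ℕ} [Fact (finrank ℝ V = n)] (o : Orientation ℝ V (Fin n)) {k l : ℕ}
    (h : k + l = n) (α : V [⋀^Fin k]→L[ℝ] ℝ) : V [⋀^Fin l]→L[ℝ] ℝ where
  toFun v := (k.factorial : ℝ)⁻¹ * ∑ f : Fin k → Fin (finrank ℝ V),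
    α (fun i => stdOrthonormalBasis ℝ V (f i)) *
      o.volumeForm (Fin.append (fun i => stdOrthonormalBasis ℝ V (f i)) v ∘ Fin.cast h.symm)
  map_update_add' := @fun inst v i x y => by
    rw [Subsingleton.elim inst (instDecidableEqFin l)]
    subst h
    simp only [append_update, Fin.cast_refl, Function.comp_id, AlternatingMap.map_update_add,
      mul_add, Finset.sum_add_distrib]
  map_update_smul' := @fun inst v i c x => by
    rw [Subsingleton.elim inst (instDecidableEqFin l)]
    subst h
    simp only [append_update, Fin.cast_refl, Function.comp_id, AlternatingMap.map_update_smul,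
      smul_eq_mul, Finset.mul_sum]
    exact Finset.sum_congr rfl fun f _ => by ring
  map_eq_zero_of_eq' v i j hv hij := by
    subst h
    have hne : Fin.natAdd k i ≠ Fin.natAdd k j := by simpa using hij
    simp only [Fin.cast_refl, Function.comp_id]
    rw [Finset.sum_eq_zero, mul_zero]
    intro f _
    rw [o.volumeForm.map_eq_zero_of_eq _ (by simpa using hv) hne, mul_zero]
  cont := by
    subst h
    have hvol : Continuous fun v : Fin (k + l) → V => o.volumeForm v :=
      o.volumeForm.toMultilinearMap.continuous_of_bound 1 fun v => by
        simpa using o.abs_volumeForm_apply_le v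
    simp only [Fin.cast_refl, Function.comp_id]
    refine continuous_const.mul (continuous_finsetSum _ fun f _ => continuous_const.mul ?_)
    refine hvol.comp (continuous_pi fun j => ?_)
    refine Fin.addCases (fun p => ?_) (fun p => ?_) j
    · simpa using continuous_const
    · simpa using continuous_apply p

end Pointwise

/-! ### Differential forms on a smooth `4`-manifold without boundary -/

section Manifold

variable {M : Type*} [TopologicalSpace M] [ChartedSpace (EuclideanSpace ℝ (Fin 4)) M]

variable (M) in
/-- A `k`-form on the `4`-manifold `M` (no regularity is imposed). -/
abbrev DForm (k : ℕ) : Type _ := ∀ x : M, TangentSpace (𝓡 4) x [⋀^Fin k]→L[ℝ] ℝ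

/-- The expression of a form in the preferred chart `φ` at `x₀`: its pullback by `φ⁻¹`. -/
def DForm.inChart {k : ℕ} (α : DForm M k) (x₀ : M) :
    EuclideanSpace ℝ (Fin 4) → EuclideanSpace ℝ (Fin 4) [⋀^Fin k]→L[ℝ] ℝ := fun y =>
  (α ((extChartAt (𝓡 4) x₀).symm y)).compContinuousLinearMap
    (mfderiv (𝓡 4) (𝓡 4) (extChartAt (𝓡 4) x₀).symm y)

/-- A form is smooth if its expressions in charts are. -/
def DForm.IsSmooth {k : ℕ} (α : DForm M k) : Prop :=
  ∀ x₀ : M, ContDiffOn ℝ ∞ (α.inChart x₀) (extChartAt (𝓡 4) x₀).target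

/-- The exterior derivative, computed at each point in the preferred chart there. -/
def DForm.d {k : ℕ} (α : DForm M k) : DForm M (k + 1) := fun x =>
  (extDeriv (α.inChart x) (extChartAt (𝓡 4) x x)).compContinuousLinearMap
    (mfderiv (𝓡 4) (𝓡 4) (extChartAt (𝓡 4) x) x)

instance (x : M) : FiniteDimensional ℝ (TangentSpace (𝓡 4) x) :=
  inferInstanceAs (FiniteDimensional ℝ (EuclideanSpace ℝ (Fin 4)))

instance (x : M) : Fact (finrank ℝ (TangentSpace (𝓡 4) x) = 4) :=
  ⟨finrank_euclideanSpace_fin (𝕜 := ℝ) (n := 4)⟩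

variable (M) in
/-- An orientation of `M`: an orientation of every tangent space, locally constant with respect to
the trivializations of the tangent bundle. -/
structure ManifoldOrientation [IsManifold (𝓡 4) ∞ M] where
  orient : ∀ x : M, Orientation ℝ (TangentSpace (𝓡 4) x) (Fin 4)
  locallyConstant : ∀ x₀ : M, ∃ o : Orientation ℝ (EuclideanSpace ℝ (Fin 4)) (Fin 4),
    ∀ᶠ x in 𝓝 x₀,
      ∀ hx : x ∈ (trivializationAt (EuclideanSpace ℝ (Fin 4))
        (TangentSpace (𝓡 4) : M → Type) x₀).baseSet,
      Orientation.map (Fin 4) ((trivializationAt (EuclideanSpace ℝ (Fin 4))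
        (TangentSpace (𝓡 4) : M → Type) x₀).continuousLinearEquivAt ℝ x hx).toLinearEquiv
          (orient x) = o

variable [IsManifold (𝓡 4) ∞ M] [RiemannianBundle (fun x : M => TangentSpace (𝓡 4) x)]

/-- The Hodge star on `k`-forms of an oriented Riemannian `4`-manifold. -/
def DForm.star (o : ManifoldOrientation M) {k l : ℕ} (h : k + l = 4) (α : DForm M k) :
    DForm M l :=
  fun x => hodgeStar (o.orient x) h (α x)

/-- The codifferential `d* = -⋆d⋆` on `2`-forms of an oriented Riemannian `4`-manifold. -/
def DForm.codifferential (o : ManifoldOrientation M) (α : DForm M 2) : DForm M 1 :=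
  -((α.star o (l := 2) rfl).d.star o rfl)

/-- The Born–Infeld field `√det(I - g⁻¹F) g (I - (g⁻¹F)²)⁻¹ g⁻¹F` of the `2`-form `F`. -/
def DForm.field (F : DForm M 2) : DForm M 2 := fun x => fieldForm (F x)

/-- `F` solves the Born–Infeld equation `d* (√det(I - g⁻¹F) g (I - (g⁻¹F)²)⁻¹ g⁻¹F) = 0`. -/
def IsBornInfeldSolution (o : ManifoldOrientation M) (F : DForm M 2) : Prop :=
  F.field.codifferential o = 0

/-- `F` is self-dual: `⋆F = F`. -/
def IsSelfDual (o : ManifoldOrientation M) (F : DForm M 2) : Prop :=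
  F.star o rfl = F

/-- `F` is anti-self-dual: `⋆F = -F`. -/
def IsAntiSelfDual (o : ManifoldOrientation M) (F : DForm M 2) : Prop :=
  F.star o rfl = -F

end Manifold

end BornInfeld

end

/-!
On an oriented Euclidean `4`-space a `2`-form `F` with `⋆F = t F`, `t = ±1`, has, in an orthonormal
basis, only three independent coefficients `x = F₀₁`, `y = F₀₂`, `z = F₀₃`, the others being
`F₂₃ = s x`, `F₁₃ = -s y`, `F₁₂ = s z` for a sign `s`
(`exists_orthonormalBasis_of_hodgeStar_eq_smul`). The matrix of `A = g⁻¹F` is therefore a multiple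
of left or right multiplication by an imaginary quaternion: `A² = -c I` and `det (I - A) = (1 + c)²`
with `c = x² + y² + z²`. Hence `√det(I - A) (I - A²)⁻¹ A = (1 + c) (1 + c)⁻¹ A = A`, that is, the
Born–Infeld field of `F` is `F` itself (`fieldForm_eq_self`). The Born–Infeld equation then reads
`d* F = -⋆d⋆F = ∓⋆dF = 0`, which holds because `F` is closed.
-/

open Module Manifold RealInnerProductSpace

namespace BornInfeld

section Pointwise

variable {V : Type*} [NormedAddCommGroup V] [InnerProductSpace ℝ V] [FiniteDimensional ℝ V]

theorem map_swap_two (F : V [⋀^Fin 2]→L[ℝ] ℝ) (v w : V) : F ![v, w] = -F ![w, v] := by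
  rw [← inner_sharp, ← inner_sharp, real_inner_comm, inner_sharp_left]

theorem map_self_two (F : V [⋀^Fin 2]→L[ℝ] ℝ) (v : V) : F ![v, v] = 0 := by
  linarith [map_swap_two F v v]

theorem fieldForm_eq_self_of_sharp_sq {F : V [⋀^Fin 2]→L[ℝ] ℝ} {c : ℝ} (hc : 0 ≤ c)
    (hsq : sharp F ^ 2 = -(c • 1)) (hdet : LinearMap.det (1 - sharp F) = (1 + c) ^ 2) :
    fieldForm F = F := by
  have hpos : 1 + c ≠ 0 := by positivity
  have hB : (1 - sharp F ^ 2 : End ℝ V) = (1 + c) • 1 := by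
    rw [hsq, add_smul, one_smul, sub_neg_eq_add]
  have hinv : Ring.inverse (1 - sharp F ^ 2 : End ℝ V) = (1 + c)⁻¹ • 1 := by
    have h := Ring.inverse_mul_cancel _ (isUnit_one_sub_sharp_sq F)
    rw [hB, mul_smul_comm, mul_one] at h
    rw [hB, eq_inv_smul_iff₀ hpos, h]
  ext v
  have hv : v = ![v 0, v 1] := by ext i; fin_cases i <;> rfl
  change √(LinearMap.det (1 - sharp F)) * ⟪v 0, resolvent F (v 1)⟫ = F v
  rw [resolvent, hinv, hdet, Real.sqrt_sq (by positivity), smul_mul_assoc, one_mul,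
    LinearMap.smul_apply, inner_smul_right, inner_sharp, ← hv, mul_inv_cancel_left₀ hpos]

/-- In dimension four, the sum over `Fin 2 → Fin (finrank ℝ V)` in the definition of the Hodge star
is a double sum over an orthonormal basis indexed by `Fin 4`. -/
theorem exists_hodgeStar_two_apply [Fact (finrank ℝ V = 4)] (o : Orientation ℝ V (Fin 4))
    (F : V [⋀^Fin 2]→L[ℝ] ℝ) : ∃ e : OrthonormalBasis (Fin 4) ℝ V, ∀ v w : V,
      hodgeStar o (l := 2) rfl F ![v, w] =
        2⁻¹ * ∑ i, ∑ j, F ![e i, e j] * o.volumeForm ![e i, e j, v, w] := by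
  refine ⟨(stdOrthonormalBasis ℝ V).reindex (finCongr Fact.out), fun v w => ?_⟩
  change ((Nat.factorial 2 : ℕ) : ℝ)⁻¹ * _ = _
  rw [Nat.factorial_two, Nat.cast_two, ← Fintype.sum_prod_type']
  congr 1
  refine Fintype.sum_equiv ((finTwoArrowEquiv _).trans
    ((finCongr Fact.out).prodCongr (finCongr Fact.out))) _ _ fun f => ?_
  congr 2
  · ext i; fin_cases i <;> simp
  · ext i; fin_cases i <;> simp <;> rfl

/-- The matrix whose columns are the standard basis vectors of indices `i, j, k, l`. Its determinant
is the Levi-Civita symbol; integer entries make its values decidable. -/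
def indexMatrix (i j k l : Fin 4) : Matrix (Fin 4) (Fin 4) ℤ :=
  .of fun a b => if ![i, j, k, l] b = a then 1 else 0

theorem det_indexMatrix_two_three : ∀ i j : Fin 4, (indexMatrix i j 2 3).det =
    if i = 0 ∧ j = 1 then 1 else if i = 1 ∧ j = 0 then -1 else 0 := by
  decide +kernel

theorem det_indexMatrix_one_three : ∀ i j : Fin 4, (indexMatrix i j 1 3).det =
    if i = 2 ∧ j = 0 then 1 else if i = 0 ∧ j = 2 then -1 else 0 := by
  decide +kernel

theorem det_indexMatrix_one_two : ∀ i j : Fin 4, (indexMatrix i j 1 2).det =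
    if i = 0 ∧ j = 3 then 1 else if i = 3 ∧ j = 0 then -1 else 0 := by
  decide +kernel

omit [FiniteDimensional ℝ V] in
/-- The sign `s` records whether `e` is positively oriented. -/
theorem exists_volumeForm_eq_mul_det [Fact (finrank ℝ V = 4)] (o : Orientation ℝ V (Fin 4))
    (e : OrthonormalBasis (Fin 4) ℝ V) : ∃ s : ℝ, s ^ 2 = 1 ∧ ∀ i j k l : Fin 4,
      o.volumeForm ![e i, e j, e k, e l] = s * ((indexMatrix i j k l).det : ℤ) := by
  have key : ∀ i j k l : Fin 4,
      e.toBasis.det ![e i, e j, e k, e l] = ((indexMatrix i j k l).det : ℤ) := by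
    intro i j k l
    rw [Basis.det_apply, Int.cast_det]
    congr 1
    ext a b
    fin_cases b <;> simp [indexMatrix, Basis.toMatrix_apply, eq_comm]
  rcases e.toBasis.orientation_eq_or_eq_neg o with h | h
  · refine ⟨1, by norm_num, fun i j k l => ?_⟩
    rw [o.volumeForm_robust e h.symm, key, one_mul]
  · refine ⟨-1, by norm_num, fun i j k l => ?_⟩
    rw [o.volumeForm_robust_neg e (by rw [h]; exact Module.Ray.ne_neg_self _),
      AlternatingMap.neg_apply, key, neg_one_mul]

/-- The coefficients of a self-dual (`t = 1`) or anti-self-dual (`t = -1`) `2`-form. The sign `s` is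
`t` times the orientation sign of `e`. -/
theorem exists_orthonormalBasis_of_hodgeStar_eq_smul [Fact (finrank ℝ V = 4)]
    (o : Orientation ℝ V (Fin 4)) {F : V [⋀^Fin 2]→L[ℝ] ℝ} {t : ℝ} (ht : t ^ 2 = 1)
    (hF : hodgeStar o (l := 2) rfl F = t • F) :
    ∃ (e : OrthonormalBasis (Fin 4) ℝ V) (s : ℝ), s ^ 2 = 1 ∧ F ![e 2, e 3] = s * F ![e 0, e 1] ∧
      F ![e 1, e 3] = -(s * F ![e 0, e 2]) ∧ F ![e 1, e 2] = s * F ![e 0, e 3] := by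
  obtain ⟨e, he⟩ := exists_hodgeStar_two_apply o F
  obtain ⟨s, hs, hvol⟩ := exists_volumeForm_eq_mul_det o e
  refine ⟨e, t * s, by rw [mul_pow, ht, hs, one_mul], ?_⟩
  -- Since `t² = 1`, the hypothesis also reads `F = t ⋆F`.
  have hstar : ∀ k l, F ![e k, e l] = t * (2⁻¹ * ∑ i, ∑ j, F ![e i, e j] *
      o.volumeForm ![e i, e j, e k, e l]) := fun k l => by
    rw [← he, hF, ContinuousAlternatingMap.smul_apply, smul_eq_mul, ← mul_assoc, ← pow_two, ht,
      one_mul]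
  refine ⟨?_, ?_, ?_⟩
  · rw [hstar 2 3]
    simp [hvol, det_indexMatrix_two_three, Fin.sum_univ_four, map_swap_two F (e 1) (e 0)]
    ring
  · rw [hstar 1 3]
    simp [hvol, det_indexMatrix_one_three, Fin.sum_univ_four, map_swap_two F (e 2) (e 0)]
    ring
  · rw [hstar 1 2]
    simp [hvol, det_indexMatrix_one_two, Fin.sum_univ_four, map_swap_two F (e 3) (e 0)]
    ring

/-- A self-dual (`t = 1`) or anti-self-dual (`t = -1`) `2`-form is its own Born–Infeld field. -/
theorem fieldForm_eq_self [Fact (finrank ℝ V = 4)] (o : Orientation ℝ V (Fin 4))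
    {F : V [⋀^Fin 2]→L[ℝ] ℝ} {t : ℝ} (ht : t ^ 2 = 1)
    (hF : hodgeStar o (l := 2) rfl F = t • F) : fieldForm F = F := by
  obtain ⟨e, s, hs, h23, h13, h12⟩ := exists_orthonormalBasis_of_hodgeStar_eq_smul o ht hF
  set x := F ![e 0, e 1]
  set y := F ![e 0, e 2]
  set z := F ![e 0, e 3]
  have hM : LinearMap.toMatrix e.toBasis e.toBasis (sharp F) =
      !![0, x, y, z; -x, 0, s * z, -(s * y); -y, -(s * z), 0, s * x; -z, s * y, -(s * x), 0] := by
    ext i j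
    have hij : LinearMap.toMatrix e.toBasis e.toBasis (sharp F) i j = F ![e i, e j] := by
      rw [LinearMap.toMatrix_apply, OrthonormalBasis.coe_toBasis,
        OrthonormalBasis.coe_toBasis_repr_apply, OrthonormalBasis.repr_apply_apply, inner_sharp]
    rw [hij]
    fin_cases i <;> fin_cases j <;>
      simp [map_self_two, h23, h13, h12, map_swap_two F (e 1) (e 0), map_swap_two F (e 2) (e 0),
        map_swap_two F (e 3) (e 0), map_swap_two F (e 2) (e 1), map_swap_two F (e 3) (e 1),
        map_swap_two F (e 3) (e 2), x, y, z]
  refine fieldForm_eq_self_of_sharp_sq (c := x ^ 2 + y ^ 2 + z ^ 2) (by positivity) ?_ ?_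
  · apply (LinearMap.toMatrix e.toBasis e.toBasis).injective
    rw [pow_two, LinearMap.toMatrix_mul, hM, map_neg, map_smul, LinearMap.toMatrix_one]
    obtain rfl | rfl := eq_or_eq_neg_of_sq_eq_sq s 1 (by rw [hs, one_pow])
    all_goals
      ext i j
      fin_cases i <;> fin_cases j <;> simp [Matrix.mul_apply, Fin.sum_univ_four] <;> ring
  · rw [← LinearMap.det_toMatrix e.toBasis, map_sub, LinearMap.toMatrix_one, hM]
    simp [Matrix.det_succ_row_zero, Fin.sum_univ_succ, Fin.succAbove, Matrix.one_apply]
    obtain rfl | rfl := eq_or_eq_neg_of_sq_eq_sq s 1 (by rw [hs, one_pow]) <;> ring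

end Pointwise

section Manifold

variable {M : Type*} [TopologicalSpace M] [ChartedSpace (EuclideanSpace ℝ (Fin 4)) M]

theorem DForm.d_neg {k : ℕ} (α : DForm M k) : (-α).d = -α.d := by
  funext x
  have h : (-α).inChart x = (-1 : ℝ) • α.inChart x := by
    funext y
    ext v
    exact (neg_one_mul _).symm
  rw [DForm.d, h, extDeriv_smul]
  ext v
  exact neg_one_mul _

variable [IsManifold (𝓡 4) ∞ M] [RiemannianBundle (fun x : M => TangentSpace (𝓡 4) x)]

theorem DForm.star_zero (o : ManifoldOrientation M) {k l : ℕ} (h : k + l = 4) :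
    (0 : DForm M k).star o h = 0 := by
  funext x
  ext v
  change (k.factorial : ℝ)⁻¹ * ∑ _, (0 : ℝ) * _ = 0
  simp

end Manifold

end BornInfeld

theorem mainTheorem6 {M : Type*} [TopologicalSpace M]
    [ChartedSpace (EuclideanSpace ℝ (Fin 4)) M] [IsManifold (𝓡 4) ∞ M]
    [RiemannianBundle (fun x : M => TangentSpace (𝓡 4) x)]
    [IsContMDiffRiemannianBundle (𝓡 4) ∞ (EuclideanSpace ℝ (Fin 4))
      (fun x : M => TangentSpace (𝓡 4) x)]
    (o : BornInfeld.ManifoldOrientation M) (F : BornInfeld.DForm M 2)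
    (hF : F.IsSmooth) (hclosed : F.d = 0)
    (hdual : BornInfeld.IsSelfDual o F ∨ BornInfeld.IsAntiSelfDual o F) :
    F.field = F ∧ BornInfeld.IsBornInfeldSolution o F := by
  have hfield : F.field = F := by
    funext x
    rcases hdual with h | h
    · exact BornInfeld.fieldForm_eq_self (o.orient x) (t := 1) (by norm_num)
        ((congrFun h x).trans (one_smul ℝ (F x)).symm)
    · exact BornInfeld.fieldForm_eq_self (o.orient x) (t := -1) (by norm_num)
        ((congrFun h x).trans (neg_one_smul ℝ (F x)).symm)
  refine ⟨hfield, ?_⟩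
  have hd : (F.star o (l := 2) rfl).d = 0 := by
    rcases hdual with h | h
    · rw [h, hclosed]
    · rw [h, BornInfeld.DForm.d_neg, hclosed, neg_zero]
  rw [BornInfeld.IsBornInfeldSolution, hfield, BornInfeld.DForm.codifferential, hd,
    BornInfeld.DForm.star_zero, neg_zero]
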